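/- Let $\Sigma=\{-1,1\}^{\mathbb Z}$ and $\Sigma^+=\{-1,1\}^{\mathbb N_0}$, with their product topologies and Borel $\sigma$-algebras, let $\sigma((s_k))=(s_{k+1})$ denote the forward shift on either space, and let $\mathrm{pr}:\Sigma\to\Sigma^+$ be the projection $(s_k)_{k\in\mathbb Z}\mapsto(s_k)_{k\ge 0}$. Let $\beta_1,\beta_2\in(0,1)$. For $\underline s\in\Sigma^+$ let $\sharp_k(\underline s)$ be the number of $i\in\{0,\dots,k\}$ with $s_i=-1$, let $$\pi^*_{\beta_1,\beta_2}(\underline s)=\sum_{k=0}^\infty s_k\,\beta_2^{\sharp_k(\underline s)}\,\beta_1^{k-\sharp_k(\underline s)+1},\qquad \pi_{\beta_1,\beta_2}=L_{\beta_1,\beta_2}\circ\pi^*_{\beta_1,\beta_2},$$ where $L_{\beta_1,\beta_2}$ is the affine map of $\mathbb R$ with $L_{\beta_1,\beta_2}\bigl(-\tfrac{\beta_2}{1-\beta_2}\bigr)=-1$ and $L_{\beta_1,\beta_2}\bigl(\tfrac{\beta_1}{1-\beta_1}\bigr)=1$. Define $\bar\pi_{\beta_1,\beta_2}:\Sigma\to[-1,1]^2$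 by $$\bar\pi_{\beta_1,\beta_2}(\underline s)=\Bigl(\pi_{\beta_1,\beta_2}(\mathrm{pr}(\underline s)),\ \sum_{k=1}^\infty s_{-k}2^{-k}\Bigr).$$ For a Borel probability measure $\mu$ on $\Sigma$ put $\bar\mu_{\beta_1,\beta_2}=\mu\circ\bar\pi_{\beta_1,\beta_2}^{-1}$ and $\hat\mu=\mu\circ\mathrm{pr}^{-1}$. Let $h(\hat\mu)$ be the metric (Kolmogorov–Sinai) entropy of $\sigma$ on $(\Sigma^+,\hat\mu)$, with natural logarithms, and let $$\Xi_{\beta_1,\beta_2}(\hat\mu)=-\bigl(\hat\mu\{\underline s\in\Sigma^+: s_0=1\}\log\beta_1+\hat\mu\{\underline s\in\Sigma^+: s_0=-1\}\log\beta_2\bigr).$$ The Hausdorff dimension of a Borel probability measure $\nu$ on $\mathbb R^2$ is $\dim_H\nu=\inf\{\dim_H B: B \text{ Borel},\ \nu(B)=1\}$. **Proposition.** For every $\sigma$-ergodic Borel probability measure $\mu$ on $\Sigma$ and all $\beta_1,\beta_2\in(0,1)$ with $\beta_1+\beta_2\ge 1$, $$\dim_H\bar\mu_{\beta_1,\beta_2}\le\frac{h(\hat\mu)}{\Xi_{\beta_1,\beta_2}(\hat\mu)}+1.$$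 -/

import Mathlib

open MeasureTheory Filter
open scoped ENNReal

noncomputable section

namespace GenBaker

/-! ### Hausdorff dimension and metric entropy of measures -/

/-- The Hausdorff dimension of a Borel probability measure: the infimum of the Hausdorff
dimensions of the Borel sets of full measure. -/
def measureDimH {X : Type*} [EMetricSpace X] [MeasurableSpace X] [BorelSpace X]
    (ν : Measure X) : ℝ≥0∞ :=
  ⨅ (B : Set X) (_ : MeasurableSet B) (_ : ν B = 1), dimH B

/-- Shannon entropy `H_μ(ξ) = -∑ μ(A) log μ(A)` of the finite partition whose cells are the
fibres of a map `ξ` into a finite type (empty cells contribute `0`). -/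
def partitionEntropy {X ι : Type*} [MeasurableSpace X] [Fintype ι]
    (μ : Measure X) (ξ : X → ι) : ℝ :=
  ∑ i, Real.negMulLog (μ.real (ξ ⁻¹' {i}))

/-- The fibres of `iterJoin T ξ n` form the partition `ξ ∨ T⁻¹ξ ∨ ⋯ ∨ T^{-(n-1)}ξ`. -/
def iterJoin {X ι : Type*} (T : X → X) (ξ : X → ι) (n : ℕ) : X → (Fin n → ι) :=
  fun x i => ξ (T^[i] x)

/-- `h_μ(T, ξ) = lim (1/n) H_μ(ξ ∨ T⁻¹ξ ∨ ⋯ ∨ T^{-(n-1)}ξ)`. For invariant `μ` the limit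
exists by subadditivity, so that it is the upper limit. -/
def entropyOfPartition {X ι : Type*} [MeasurableSpace X] [Fintype ι]
    (T : X → X) (μ : Measure X) (ξ : X → ι) : ℝ≥0∞ :=
  limsup (fun n : ℕ => ENNReal.ofReal (partitionEntropy μ (iterJoin T ξ n) / n)) atTop

/-- The metric (Kolmogorov–Sinai) entropy `h(μ)` of `T` with respect to `μ`: the supremum of
`h_μ(T, ξ)` over all finite measurable partitions `ξ`. A finite measurable partition is given
as a measurable map into some `Fin k`, its cells being the fibres. -/
def metricEntropy {X : Type*} [MeasurableSpace X] (T : X → X) (μ : Measure X) : ℝ≥0∞ :=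
  ⨆ (k : ℕ) (ξ : X → Fin k) (_ : Measurable ξ), entropyOfPartition T μ ξ

/-! ### The shift spaces -/

/-- The two-sided shift space `{-1, 1}^ℤ`, with its product topology and product σ-algebra;
the alphabet `{-1, 1}` is the type `ℤˣ`. -/
abbrev TwoSided : Type := ℤ → ℤˣ

/-- The one-sided shift space `{-1, 1}^{ℕ₀}`. -/
abbrev OneSided : Type := ℕ → ℤˣ

/-- The forward shift on `{-1, 1}^ℤ`. -/
def shift (s : TwoSided) : TwoSided := fun k => s (k + 1)

/-- The forward shift on `{-1, 1}^{ℕ₀}`. -/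
def shiftOne (s : OneSided) : OneSided := fun k => s (k + 1)

/-- The projection from `{-1, 1}^ℤ` to `{-1, 1}^{ℕ₀}`. -/
def pr (s : TwoSided) : OneSided := fun k => s (k : ℤ)

/-- The one-sided marginal `μ̂ = μ ∘ pr⁻¹`. -/
def marginal (μ : Measure TwoSided) : Measure OneSided := μ.map pr

/-! ### The coding map -/

/-- The number of indices `0 ≤ i ≤ k` with `s i = -1`. -/
def numNeg (s : OneSided) (k : ℕ) : ℕ :=
  ((Finset.range (k + 1)).filter (fun i => s i = -1)).card

/-- `π*(s) = ∑_{k ≥ 0} s_k β₂^{#_k(s)} β₁^{k - #_k(s) + 1}` with `#_k(s)` as in `numNeg`.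
Since `#_k(s) ≤ k + 1`, the subtraction in the exponent is never truncated. -/
def codeStar (β₁ β₂ : ℝ) (s : OneSided) : ℝ :=
  ∑' k : ℕ, ((s k : ℤ) : ℝ) * β₂ ^ numNeg s k * β₁ ^ (k + 1 - numNeg s k)

/-- The affine map of the line sending `-β₂/(1-β₂)` to `-1` and `β₁/(1-β₁)` to `1`. -/
def rescale (β₁ β₂ : ℝ) (x : ℝ) : ℝ :=
  2 * (x - (-β₂ / (1 - β₂))) / (β₁ / (1 - β₁) - (-β₂ / (1 - β₂))) - 1

/-- The coding map `π = L ∘ π*` of the first coordinate. -/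
def codeFst (β₁ β₂ : ℝ) (s : OneSided) : ℝ := rescale β₁ β₂ (codeStar β₁ β₂ s)

/-- The signed dyadic expansion `∑_{k ≥ 1} s_{-k} 2^{-k}`, coding the second coordinate; the
summation index below is `k - 1`. -/
def codeSnd (s : TwoSided) : ℝ :=
  ∑' j : ℕ, ((s (-((j : ℤ) + 1)) : ℤ) : ℝ) * ((2 : ℝ) ^ (j + 1))⁻¹

/-- The coding map from `{-1, 1}^ℤ` to the square `[-1, 1]²` in the Euclidean plane. -/
def code (β₁ β₂ : ℝ) (s : TwoSided) : EuclideanSpace ℝ (Fin 2) :=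
  !₂[codeFst β₁ β₂ (pr s), codeSnd s]

/-- The projected measure `μ ∘ code⁻¹` on the square. -/
def projected (β₁ β₂ : ℝ) (μ : Measure TwoSided) : Measure (EuclideanSpace ℝ (Fin 2)) :=
  μ.map (code β₁ β₂)

/-- `Ξ(ν) = -(ν{s₀ = 1} log β₁ + ν{s₀ = -1} log β₂)`. -/
def xi (β₁ β₂ : ℝ) (ν : Measure OneSided) : ℝ :=
  -(ν.real {s | s 0 = 1} * Real.log β₁ + ν.real {s | s 0 = -1} * Real.log β₂)

end GenBaker

end

namespace GenBaker

/-! Fix `t = h/Ξ + ε`. On the cylinder of a word `w` the first coordinate varies by at most a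
constant times `scale b w`, while the second is free in `[-1, 1]`. So about `1 / scale b w` sets of
diameter comparable to `scale b w` cover the image, and their cost in dimension `t + 1` is of order
`scale b w ^ t`. For good words this is at most `K e^{-ηn} ν[w]`, so the total cost at level `n` is
`O(e^{-ηn})`. By Borel–Cantelli, the image of the points with infinitely many good prefixes is `μH[t
+ 1]`-null (`hausdorffMeasure_code_goodPoints_eq_zero`). Overlaps of cylinder images do no harm to
an upper bound.

It remains to see that almost every point is of this kind (`ae_mem_goodPoints`). A first-moment
estimate replaces the Shannon–McMillan–Breiman theorem. The mean of `log ν[w] - t log (scale b w)`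
over words of length `n` exceeds `2ηn`, and its values are at most `tMn`, so good words carry a mass
bounded below for all large `n` (`le_measureReal_goodWords`). The reverse Fatou lemma yields a set
of positive measure. This set is forward invariant, and ergodicity makes it full. -/

instance : MeasurableSingletonClass ℤˣ where
  measurableSet_singleton u :=
    ⟨{(u : ℤ)}, measurableSet_singleton _, by ext v; simp [Units.ext_iff]⟩

/-! ### General lemmas -/

/-- Reverse Fatou lemma for sets. -/
theorem le_measure_frequently {X : Type*} [MeasurableSpace X] {ν : Measure X} [IsFiniteMeasure ν]
    {A : ℕ → Set X} (hA : ∀ n, MeasurableSet (A n)) {c : ℝ≥0∞}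
    (hc : ∀ᶠ n in atTop, c ≤ ν (A n)) : c ≤ ν {x | ∃ᶠ n in atTop, x ∈ A n} := by
  have hset : {x | ∃ᶠ n in atTop, x ∈ A n} = ⋂ N, ⋃ n, A (N + n) := by
    ext x
    simp only [frequently_atTop, Set.mem_ofPred_eq, Set.mem_iInter, Set.mem_iUnion]
    refine forall_congr' fun N => ⟨fun ⟨n, hn, hx⟩ => ⟨n - N, ?_⟩, fun ⟨n, hx⟩ => ⟨N + n, by omega, hx⟩⟩
    rwa [Nat.add_sub_cancel' hn]
  rw [hset]
  have hanti : Antitone fun N => ⋃ n, A (N + n) := by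
    intro M N hMN x hx
    obtain ⟨n, hn⟩ := Set.mem_iUnion.1 hx
    refine Set.mem_iUnion.2 ⟨N - M + n, ?_⟩
    rwa [← add_assoc, Nat.add_sub_cancel' hMN]
  have hlim := tendsto_measure_iInter_atTop (μ := ν)
    (fun N => (MeasurableSet.iUnion fun n => hA (N + n)).nullMeasurableSet) hanti
    ⟨0, measure_ne_top _ _⟩
  refine ge_of_tendsto hlim ?_
  filter_upwards [hc] with N hN
  exact hN.trans (measure_mono (Set.subset_iUnion_of_subset 0 (by simp)))

theorem measurableSet_frequently {X : Type*} [MeasurableSpace X] {A : ℕ → Set X}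
    (hA : ∀ n, MeasurableSet (A n)) : MeasurableSet {x | ∃ᶠ n in atTop, x ∈ A n} := by
  have hset : {x | ∃ᶠ n in atTop, x ∈ A n} = ⋂ N, ⋃ n, ⋃ (_ : N ≤ n), A n := by
    ext x
    simp [frequently_atTop]
  rw [hset]
  exact .iInter fun N => .iUnion fun n => .iUnion fun _ => hA n

/-- Borel–Cantelli lemma for Hausdorff measures: the premeasures of the coverings are summable, so
the points lying in infinitely many of the sets form a null set. -/
theorem hausdorffMeasure_frequently_eq_zero {X : Type*} [EMetricSpace X] [MeasurableSpace X]
    [BorelSpace X] {d : ℝ} (hd : 0 < d) {A : ℕ → Set X} {ι : ℕ → Type*} [∀ n, Countable (ι n)]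
    (U : ∀ n, ι n → Set X) (hA : ∀ n, A n ⊆ ⋃ i, U n i)
    (hsum : ∑' n, ∑' i, Metric.ediam (U n i) ^ d ≠ ∞) :
    μH[d] {x | ∃ᶠ n in atTop, x ∈ A n} = 0 := by
  set c : ℕ → ℝ≥0∞ := fun n => ∑' i, Metric.ediam (U n i) ^ d with hc
  have htail : Tendsto (fun N => ∑' n, c (n + N)) atTop (nhds 0) :=
    ENNReal.tendsto_sum_nat_add c hsum
  -- Each single `ediam ^ d` is at most the whole tail, so the `d`-th root of the tail serves as
  -- mesh; no separate smallness of the cover is needed.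
  have hr : Tendsto (fun N => (∑' n, c (n + N)) ^ d⁻¹) atTop (nhds 0) := by
    have := (ENNReal.continuous_rpow_const (y := d⁻¹)).tendsto 0 |>.comp htail
    simpa [ENNReal.zero_rpow_of_pos (inv_pos.2 hd), Function.comp_def] using this
  have key := Measure.hausdorffMeasure_le_liminf_tsum (ι := fun N => Σ n, ι (n + N)) d
    {x | ∃ᶠ n in atTop, x ∈ A n} _ hr (fun N p => U (p.1 + N) p.2)
    (.of_forall fun N p => ?_) (.of_forall fun N x hx => ?_)
  · refine le_antisymm (key.trans ?_) zero_le
    simp_rw [ENNReal.tsum_sigma']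
    exact htail.liminf_eq.le
  · rw [ENNReal.le_rpow_inv_iff hd]
    exact (ENNReal.le_tsum (f := fun i => Metric.ediam (U (p.1 + N) i) ^ d) p.2).trans
      (ENNReal.le_tsum (f := fun n => c (n + N)) p.1)
  · obtain ⟨n, hn, hx⟩ := frequently_atTop.1 hx N
    obtain ⟨i, hi⟩ := Set.mem_iUnion.1 (hA n hx)
    obtain ⟨m, rfl⟩ := Nat.exists_eq_add_of_le' hn
    exact Set.mem_iUnion.2 ⟨⟨m, i⟩, hi⟩

theorem measureDimH_le_of_hausdorffMeasure_eq_zero {Ω X : Type*} [MeasurableSpace Ω]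
    [EMetricSpace X] [MeasurableSpace X] [BorelSpace X] {μ : Measure Ω} [IsProbabilityMeasure μ]
    {f : Ω → X} (hf : Measurable f) {E : Set Ω} (hE : ∀ᵐ s ∂μ, s ∈ E) {d : NNReal}
    (hd : μH[d] (f '' E) = 0) : measureDimH (μ.map f) ≤ d := by
  -- The image need not be Borel; its measurable hull for `μH[d]` is Borel and still null.
  set B := toMeasurable μH[(d : ℝ)] (f '' E)
  have hB : MeasurableSet B := measurableSet_toMeasurable _ _
  have hν : μ.map f B = 1 := by
    rw [Measure.map_apply hf hB, ← mem_ae_iff_prob_eq_one (hf hB)]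
    filter_upwards [hE] with s hs
    exact subset_toMeasurable _ _ (Set.mem_image_of_mem f hs)
  unfold measureDimH
  refine (iInf₂_le_of_le B hB (iInf_le _ hν)).trans ?_
  refine dimH_le_of_hausdorffMeasure_ne_top ?_
  rw [measure_toMeasurable, hd]
  exact ENNReal.zero_ne_top

/-- Integral of a function of a finitely-valued random variable. -/
theorem integral_comp_eq_sum {X ι : Type*} [MeasurableSpace X] [Fintype ι] [MeasurableSpace ι]
    [MeasurableSingletonClass ι] {ν : Measure X} [IsFiniteMeasure ν] {ξ : X → ι}
    (hξ : Measurable ξ) (g : ι → ℝ) :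
    ∫ x, g (ξ x) ∂ν = ∑ i, ν.real (ξ ⁻¹' {i}) * g i := by
  rw [← integral_map (f := g) hξ.aemeasurable (measurable_of_finite g).aestronglyMeasurable,
    integral_fintype .of_finite]
  refine Finset.sum_congr rfl fun i _ => ?_
  rw [measureReal_def, Measure.map_apply hξ (measurableSet_singleton i), smul_eq_mul,
    measureReal_def]

/-- The entropy of any finite measurable partition is at most the metric entropy. -/
theorem entropyOfPartition_le_metricEntropy {X ι : Type*} [MeasurableSpace X] [Fintype ι]
    [MeasurableSpace ι] [MeasurableSingletonClass ι] (T : X → X) (ν : Measure X) {ξ : X → ι}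
    (hξ : Measurable ξ) : entropyOfPartition T ν ξ ≤ metricEntropy T ν := by
  let e := Fintype.equivFin ι
  have h : entropyOfPartition T ν (e ∘ ξ) = entropyOfPartition T ν ξ := by
    unfold entropyOfPartition partitionEntropy
    congr 1
    funext n
    congr 2
    refine (Fintype.sum_equiv (Equiv.piCongrRight fun _ : Fin n => e) _ _ fun w => ?_).symm
    congr 2
    ext x
    simp [iterJoin, funext_iff]
  rw [← h]
  exact le_iSup_of_le _ (le_iSup_of_le (e ∘ ξ)
    (le_iSup_of_le ((measurable_of_finite e).comp hξ) le_rfl))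

/-! ### Words and cylinders -/

/-- The initial word of length `n`. -/
def word (n : ℕ) (s : OneSided) : Fin n → ℤˣ := fun i => s i

/-- The product of the weights `b` of the first `n` letters. -/
def scale (b : ℤˣ → ℝ) {n : ℕ} (w : Fin n → ℤˣ) : ℝ := ∏ i, b (w i)

/-- The measure of the cylinder of a word. -/
def cyl (ν : Measure OneSided) {n : ℕ} (w : Fin n → ℤˣ) : ℝ := ν.real (word n ⁻¹' {w})

theorem measurable_word (n : ℕ) : Measurable (word n) :=
  measurable_pi_lambda _ fun i => measurable_pi_apply (i : ℕ)

theorem measurable_shiftOne : Measurable shiftOne :=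
  measurable_pi_lambda _ fun k => measurable_pi_apply (k + 1)

theorem iterate_shiftOne (i : ℕ) (s : OneSided) : shiftOne^[i] s = fun k => s (k + i) := by
  induction i generalizing s with
  | zero => rfl
  | succ i ih =>
    rw [Function.iterate_succ_apply, ih]
    rfl

theorem iterJoin_shiftOne (n : ℕ) : iterJoin shiftOne (fun s => s 0) n = word n := by
  funext s i
  simp [iterJoin, word, iterate_shiftOne]

theorem scale_pos {b : ℤˣ → ℝ} (hb : ∀ u, 0 < b u) {n : ℕ} (w : Fin n → ℤˣ) : 0 < scale b w :=
  Finset.prod_pos fun _ _ => hb _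

theorem scale_le_one {b : ℤˣ → ℝ} (hb : ∀ u, 0 < b u) (hb1 : ∀ u, b u < 1) {n : ℕ}
    (w : Fin n → ℤˣ) : scale b w ≤ 1 :=
  Finset.prod_le_one (fun _ _ => (hb _).le) fun _ _ => (hb1 _).le

theorem scale_word_succ (b : ℤˣ → ℝ) (n : ℕ) (s : OneSided) :
    scale b (word (n + 1) s) = b (s 0) * scale b (word n (shiftOne s)) := by
  simp [scale, word, Fin.prod_univ_succ, shiftOne]

theorem cyl_nonneg (ν : Measure OneSided) {n : ℕ} (w : Fin n → ℤˣ) : 0 ≤ cyl ν w :=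
  measureReal_nonneg

theorem sum_cyl (ν : Measure OneSided) [IsProbabilityMeasure ν] (n : ℕ) :
    ∑ w : Fin n → ℤˣ, cyl ν w = 1 := by
  have := integral_comp_eq_sum (ν := ν) (measurable_word n) fun _ => (1 : ℝ)
  simpa [cyl] using this.symm

theorem sum_cyl_filter (ν : Measure OneSided) [IsProbabilityMeasure ν] {n : ℕ}
    (G : Set (Fin n → ℤˣ)) [DecidablePred (· ∈ G)] :
    ∑ w with w ∈ G, cyl ν w = ν.real (word n ⁻¹' G) := by
  have := integral_comp_eq_sum (ν := ν) (measurable_word n) (G.indicator 1)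
  have h2 : (fun x => G.indicator (1 : (Fin n → ℤˣ) → ℝ) (word n x)) = (word n ⁻¹' G).indicator 1 := by
    ext x; simp [Set.indicator]
  rw [h2, integral_indicator_one (measurable_word n G.toFinite.measurableSet)] at this
  rw [this, Finset.sum_filter]
  exact Finset.sum_congr rfl fun w _ => by simp [cyl, Set.indicator]

theorem cyl_word_succ_le {ν : Measure OneSided} [IsFiniteMeasure ν]
    (hν : MeasurePreserving shiftOne ν ν) (n : ℕ) (s : OneSided) :
    cyl ν (word (n + 1) s) ≤ cyl ν (word n (shiftOne s)) := by
  unfold cyl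
  rw [← hν.measureReal_preimage
    (measurable_word n (measurableSet_singleton _)).nullMeasurableSet]
  refine measureReal_mono fun x hx => ?_
  simp only [Set.mem_preimage, Set.mem_singleton_iff, funext_iff, word, shiftOne] at hx ⊢
  exact fun i => hx i.succ

/-- The mean logarithm of the scale of words of length `n` is `n` times that of letters. -/
theorem sum_cyl_mul_log_scale {ν : Measure OneSided} [IsProbabilityMeasure ν]
    (hν : MeasurePreserving shiftOne ν ν) {b : ℤˣ → ℝ} (hb : ∀ u, 0 < b u) (n : ℕ) :
    ∑ w : Fin n → ℤˣ, cyl ν w * Real.log (scale b w) = n * ∫ s, Real.log (b (s 0)) ∂ν := by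
  have hlog : Measurable fun u : ℤˣ => Real.log (b u) := measurable_of_finite _
  have hint : ∀ i, Integrable (fun s : OneSided => Real.log (b (s i))) ν := fun i =>
    (Integrable.of_finite (μ := ν.map fun s => s i)).comp_measurable
      (f := fun s : OneSided => s i) (g := fun u => Real.log (b u)) (measurable_pi_apply i)
  have hstat : ∀ i, ∫ s, Real.log (b (s i)) ∂ν = ∫ s, Real.log (b (s 0)) ∂ν := fun i => by
    have hi := hν.iterate i
    conv_rhs => rw [← hi.map_eq]
    rw [integral_map (f := fun s : OneSided => Real.log (b (s 0))) hi.aemeasurable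
      (hlog.comp (measurable_pi_apply 0)).aestronglyMeasurable]
    simp [iterate_shiftOne]
  have h := integral_comp_eq_sum (ν := ν) (measurable_word n) fun w => Real.log (scale b w)
  unfold cyl
  rw [← h]
  simp only [scale, Real.log_prod (fun _ _ => (hb _).ne'), word]
  rw [integral_finsetSum _ fun (i : Fin n) _ => hint i]
  simp [hstat]

/-! ### Words whose cylinders are large compared with their scale -/

/-- The words `w` of length `n` with `scale b w ^ t ≤ K e^{-ηn} ν[w]`. -/
def goodWords (ν : Measure OneSided) (b : ℤˣ → ℝ) (t η K : ℝ) (n : ℕ) : Set (Fin n → ℤˣ) :=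
  {w | scale b w ^ t ≤ K * Real.exp (-(η * n)) * cyl ν w}

/-- The points with infinitely many good initial words, for some constant `K`. -/
def goodPoints (ν : Measure OneSided) (b : ℤˣ → ℝ) (t η : ℝ) : Set OneSided :=
  {s | ∃ K : ℕ, ∃ᶠ n in atTop, word n s ∈ goodWords ν b t η K n}

/-- A Markov-type bound: the log-ratio `log ν[w] - t log (scale b w)` is at most `ηn` on bad words
and at most `tMn` on good ones, while its mean exceeds `2ηn` by `hH`. Good words must account for
the remaining `ηn`. -/
theorem le_measureReal_goodWords {ν : Measure OneSided} [IsProbabilityMeasure ν]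
    (hν : MeasurePreserving shiftOne ν ν) {b : ℤˣ → ℝ} (hb : ∀ u, 0 < b u) {t η M : ℝ}
    (ht : 0 < t) (hη : 0 < η) (hM : 0 < M) (hbM : ∀ u, -Real.log (b u) ≤ M) {n : ℕ} (hn : 0 < n)
    (hH : partitionEntropy ν (word n) / n < t * -∫ s, Real.log (b (s 0)) ∂ν - 2 * η) :
    η / (t * M) ≤ ν.real (word n ⁻¹' goodWords ν b t η 1 n) := by
  classical
  have hn' : (0 : ℝ) < n := by exact_mod_cast hn
  have hpt : ∀ w : Fin n → ℤˣ, cyl ν w * Real.log (cyl ν w) - t * (cyl ν w * Real.log (scale b w)) ≤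
      cyl ν w * (η * n) + if w ∈ goodWords ν b t η 1 n then cyl ν w * (t * (n * M)) else 0 := by
    intro w
    have h0 := cyl_nonneg ν w
    have hs := scale_pos hb w
    have hηn : 0 < η * n := mul_pos hη hn'
    split_ifs with hw
    · have h1 : Real.log (cyl ν w) ≤ 0 := Real.log_nonpos h0 measureReal_le_one
      have h2 : -Real.log (scale b w) ≤ n * M := by
        rw [scale, Real.log_prod fun _ _ => (hb _).ne', ← Finset.sum_neg_distrib]
        exact (Finset.sum_le_card_nsmul _ _ M fun _ _ => hbM _).trans (by simp)
      have h3 := mul_le_mul_of_nonneg_left h2 ht.le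
      nlinarith [mul_le_mul_of_nonneg_left
        (show Real.log (cyl ν w) - t * Real.log (scale b w) ≤ η * n + t * (n * M) by linarith) h0]
    · rcases h0.eq_or_lt with h0 | h0
      · simp [← h0]
      · rw [goodWords, Set.mem_ofPred_eq, not_le, one_mul] at hw
        have h1 := Real.log_lt_log (mul_pos (Real.exp_pos _) h0) hw
        rw [Real.log_mul (Real.exp_pos _).ne' h0.ne', Real.log_exp, Real.log_rpow hs] at h1
        nlinarith [mul_le_mul_of_nonneg_left
          (show Real.log (cyl ν w) - t * Real.log (scale b w) ≤ η * n by linarith) h0.le]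
  have hsum := Finset.sum_le_sum fun w (_ : w ∈ Finset.univ) => hpt w
  rw [Finset.sum_sub_distrib, ← Finset.mul_sum, sum_cyl_mul_log_scale hν hb,
    Finset.sum_add_distrib, ← Finset.sum_mul, sum_cyl, ← Finset.sum_filter, ← Finset.sum_mul,
    sum_cyl_filter] at hsum
  have hent : ∑ w : Fin n → ℤˣ, cyl ν w * Real.log (cyl ν w) = -partitionEntropy ν (word n) := by
    simp [partitionEntropy, Real.negMulLog, cyl]
  rw [hent] at hsum
  rw [div_lt_iff₀ hn'] at hH
  rw [div_le_iff₀ (mul_pos ht hM)]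
  refine le_of_mul_le_mul_right ?_ hn'
  nlinarith

theorem measurableSet_goodPoints (ν : Measure OneSided) (b : ℤˣ → ℝ) (t η : ℝ) :
    MeasurableSet (goodPoints ν b t η) := by
  have h : goodPoints ν b t η =
      ⋃ K : ℕ, {s | ∃ᶠ n in atTop, s ∈ word n ⁻¹' goodWords ν b t η K n} := by
    ext s; simp [goodPoints]
  rw [h]
  exact .iUnion fun K => measurableSet_frequently fun n =>
    measurable_word n (Set.toFinite _).measurableSet

/-- Deleting the first letter divides `scale ^ t` by the fixed factor `b (s 0) ^ t` and does not
decrease the cylinder's measure. The constant `K` is left free in `goodPoints` to absorb this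
factor, and is a natural number to keep unions over it countable. -/
theorem shiftOne_mem_goodPoints {ν : Measure OneSided} [IsProbabilityMeasure ν]
    (hν : MeasurePreserving shiftOne ν ν) {b : ℤˣ → ℝ} (hb : ∀ u, 0 < b u) {t η : ℝ}
    (hη : 0 < η) {s : OneSided} (hs : s ∈ goodPoints ν b t η) :
    shiftOne s ∈ goodPoints ν b t η := by
  obtain ⟨K, hK⟩ := hs
  refine ⟨⌈b (s 0) ^ (-t) * K⌉₊, ?_⟩
  rw [frequently_atTop] at hK ⊢
  intro N
  obtain ⟨m, hm, hg⟩ := hK (N + 1)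
  obtain ⟨n, rfl⟩ := Nat.exists_eq_add_of_le' (le_trans (Nat.le_add_left 1 N) hm)
  refine ⟨n, by omega, ?_⟩
  simp only [goodWords, Set.mem_ofPred_eq, scale_word_succ] at hg ⊢
  have hb0 := Real.rpow_pos_of_pos (hb (s 0)) (-t)
  have hsc := scale_pos hb (word n (shiftOne s))
  rw [Real.mul_rpow (hb _).le hsc.le] at hg
  have hexp : Real.exp (-(η * (n + 1 : ℕ))) ≤ Real.exp (-(η * n)) := by
    apply Real.exp_le_exp.2
    push_cast
    nlinarith
  calc scale b (word n (shiftOne s)) ^ t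
      = b (s 0) ^ (-t) * (b (s 0) ^ t * scale b (word n (shiftOne s)) ^ t) := by
        rw [← mul_assoc, ← Real.rpow_add (hb _)]; simp
    _ ≤ b (s 0) ^ (-t) * (K * Real.exp (-(η * (n + 1 : ℕ))) * cyl ν (word (n + 1) s)) := by gcongr
    _ ≤ b (s 0) ^ (-t) * (K * Real.exp (-(η * n)) * cyl ν (word n (shiftOne s))) := by
        gcongr
        · exact cyl_nonneg _ _
        · exact cyl_word_succ_le hν n s
    _ = b (s 0) ^ (-t) * K * Real.exp (-(η * n)) * cyl ν (word n (shiftOne s)) := by ring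
    _ ≤ _ := by
        gcongr
        · exact cyl_nonneg _ _
        · exact Nat.le_ceil _

theorem ae_mem_goodPoints {ν : Measure OneSided} [IsProbabilityMeasure ν]
    (hν : Ergodic shiftOne ν) {b : ℤˣ → ℝ} (hb : ∀ u, 0 < b u) {t η : ℝ}
    (ht : 0 < t) (hη : 0 < η)
    (hh : metricEntropy shiftOne ν <
      ENNReal.ofReal (t * -∫ s, Real.log (b (s 0)) ∂ν - 2 * η)) :
    ∀ᵐ s ∂ν, s ∈ goodPoints ν b t η := by
  set M : ℝ := 1 + ∑ u, |Real.log (b u)|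
  have hM : 0 < M := by positivity
  have hbM : ∀ u, -Real.log (b u) ≤ M := fun u => by
    have := Finset.single_le_sum (f := fun u => |Real.log (b u)|) (fun _ _ => abs_nonneg _)
      (Finset.mem_univ u)
    have := neg_abs_le (Real.log (b u))
    simp only [M]
    linarith
  -- Only the trivial inequality for the first-letter partition is used, not that it generates.
  have hent := (entropyOfPartition_le_metricEntropy shiftOne ν
    (ξ := fun s : OneSided => s 0) (measurable_pi_apply 0)).trans_lt hh
  simp only [entropyOfPartition, iterJoin_shiftOne] at hent
  have hpos : 0 < ν {s | ∃ᶠ n in atTop, s ∈ word n ⁻¹' goodWords ν b t η (1 : ℕ) n} := by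
    refine (ENNReal.ofReal_pos.2 (div_pos hη (mul_pos ht hM))).trans_le
      (le_measure_frequently (fun n => measurable_word n (Set.toFinite _).measurableSet) ?_)
    filter_upwards [eventually_lt_of_limsup_lt hent, eventually_gt_atTop 0] with n hn hn0
    rw [← ofReal_measureReal]
    refine ENNReal.ofReal_le_ofReal ?_
    rw [Nat.cast_one]
    exact le_measureReal_goodWords hν.toMeasurePreserving hb ht hη hM hbM hn0
      ((ENNReal.ofReal_lt_ofReal_iff_of_nonneg (by
        refine div_nonneg (Finset.sum_nonneg fun w _ => ?_) n.cast_nonneg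
        exact Real.negMulLog_nonneg measureReal_nonneg measureReal_le_one)).1 hn)
  rcases hν.ae_empty_or_univ_of_ae_le_preimage
    (measurableSet_goodPoints ν b t η).nullMeasurableSet
    (LE.le.eventuallyLE fun s hs => shiftOne_mem_goodPoints hν.toMeasurePreserving hb hη hs)
    with h | h
  · refine absurd (ae_eq_empty.1 h) (hpos.trans_le (measure_mono fun s hs => ?_)).ne'
    exact ⟨1, hs⟩
  · exact eventuallyEq_univ.1 h

/-! ### The coding map -/

/-- The contraction ratio attached to a letter. -/
def ratio (β₁ β₂ : ℝ) (u : ℤˣ) : ℝ := if u = -1 then β₂ else β₁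

/-- As a product over letters, the weight splits off its first factor, which gives the
self-similarity. -/
theorem codeStar_eq (β₁ β₂ : ℝ) (s : OneSided) :
    codeStar β₁ β₂ s = ∑' k : ℕ, ((s k : ℤ) : ℝ) * scale (ratio β₁ β₂) (word (k + 1) s) := by
  unfold codeStar
  refine tsum_congr fun k => ?_
  rw [mul_assoc]
  congr 1
  have hcard : ((Finset.range (k + 1)).filter fun i => ¬s i = -1).card = k + 1 - numNeg s k := by
    have := Finset.card_filter_add_card_filter_not (s := Finset.range (k + 1)) fun i => s i = -1
    rw [Finset.card_range] at this
    unfold numNeg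
    omega
  have hscale : scale (ratio β₁ β₂) (word (k + 1) s) =
      ∏ i ∈ Finset.range (k + 1), if s i = -1 then β₂ else β₁ :=
    (Finset.prod_range fun i => ratio β₁ β₂ (s i)).symm
  rw [hscale, Finset.prod_ite, Finset.prod_const, Finset.prod_const, hcard, numNeg]

theorem measurable_scale_word (b : ℤˣ → ℝ) (n : ℕ) : Measurable fun s => scale b (word n s) :=
  (measurable_of_finite (scale b)).comp (measurable_word n)

theorem measurable_codeStar (β₁ β₂ : ℝ) : Measurable (codeStar β₁ β₂) := by
  rw [funext (codeStar_eq β₁ β₂)]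
  refine Measurable.tsum fun k => .mul ?_ (measurable_scale_word _ _)
  exact (measurable_of_finite fun u : ℤˣ => ((u : ℤ) : ℝ)).comp (measurable_pi_apply k)

theorem measurable_codeSnd : Measurable codeSnd := by
  refine Measurable.tsum fun j => .mul_const ?_ _
  exact (measurable_of_finite fun u : ℤˣ => ((u : ℤ) : ℝ)).comp (measurable_pi_apply _)

theorem measurable_pr : Measurable pr :=
  measurable_pi_lambda _ fun k => measurable_pi_apply (k : ℤ)

theorem measurable_code (β₁ β₂ : ℝ) : Measurable (code β₁ β₂) := by
  have h1 : Measurable fun s => codeFst β₁ β₂ (pr s) := by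
    have := (measurable_codeStar β₁ β₂).comp measurable_pr
    simp only [codeFst, rescale]
    exact (((this.sub_const _).const_mul _).div_const _).sub_const _
  refine (WithLp.measurable_toLp 2 (Fin 2 → ℝ)).comp (measurable_pi_lambda _ fun i => ?_)
  fin_cases i
  · exact h1
  · exact measurable_codeSnd

theorem abs_letter (u : ℤˣ) : |((u : ℤ) : ℝ)| = 1 := by
  rcases Int.units_eq_one_or u with rfl | rfl <;> simp

theorem abs_codeSnd_le (s : TwoSided) : |codeSnd s| ≤ 1 := by
  have h : HasSum (fun j : ℕ => ((2 : ℝ) ^ (j + 1))⁻¹) 1 := by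
    have := hasSum_geometric_two.mul_left (1 / 2 : ℝ)
    simpa [pow_succ, mul_comm] using this
  rw [← Real.norm_eq_abs]
  refine tsum_of_norm_bounded h fun j => ?_
  rw [norm_mul, Real.norm_eq_abs, abs_letter, one_mul, Real.norm_of_nonneg (by positivity)]

section

variable {β₁ β₂ : ℝ}

theorem ratio_pos (h₁ : 0 < β₁) (h₂ : 0 < β₂) (u : ℤˣ) : 0 < ratio β₁ β₂ u := by
  unfold ratio; split_ifs <;> assumption

theorem ratio_lt_one (h₁ : β₁ < 1) (h₂ : β₂ < 1) (u : ℤˣ) : ratio β₁ β₂ u < 1 := by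
  unfold ratio; split_ifs <;> assumption

theorem norm_code_term_le (hβ₁ : β₁ ∈ Set.Ioo (0 : ℝ) 1) (hβ₂ : β₂ ∈ Set.Ioo (0 : ℝ) 1)
    (s : OneSided) (k : ℕ) :
    ‖((s k : ℤ) : ℝ) * scale (ratio β₁ β₂) (word (k + 1) s)‖ ≤ max β₁ β₂ ^ k := by
  have h0 := ratio_pos hβ₁.1 hβ₂.1
  have hmax : ∀ u, ratio β₁ β₂ u ≤ max β₁ β₂ := fun u => by unfold ratio; split_ifs <;> simp
  have hm0 : 0 ≤ max β₁ β₂ := hβ₁.1.le.trans (le_max_left _ _)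
  rw [norm_mul, Real.norm_eq_abs, abs_letter, one_mul,
    Real.norm_of_nonneg (scale_pos h0 _).le]
  calc scale (ratio β₁ β₂) (word (k + 1) s) ≤ ∏ _i : Fin (k + 1), max β₁ β₂ :=
        Finset.prod_le_prod (fun _ _ => (h0 _).le) fun _ _ => hmax _
    _ = max β₁ β₂ ^ (k + 1) := by simp
    _ ≤ max β₁ β₂ ^ k := pow_le_pow_of_le_one hm0 (max_lt hβ₁.2 hβ₂.2).le (Nat.le_succ k)

theorem hasSum_geometric_max (hβ₁ : β₁ ∈ Set.Ioo (0 : ℝ) 1) (hβ₂ : β₂ ∈ Set.Ioo (0 : ℝ) 1) :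
    HasSum (fun k : ℕ => max β₁ β₂ ^ k) (1 - max β₁ β₂)⁻¹ :=
  hasSum_geometric_of_lt_one (hβ₁.1.le.trans (le_max_left _ _)) (max_lt hβ₁.2 hβ₂.2)

theorem abs_codeStar_le (hβ₁ : β₁ ∈ Set.Ioo (0 : ℝ) 1) (hβ₂ : β₂ ∈ Set.Ioo (0 : ℝ) 1)
    (s : OneSided) : |codeStar β₁ β₂ s| ≤ (1 - max β₁ β₂)⁻¹ := by
  rw [codeStar_eq]
  exact tsum_of_norm_bounded (hasSum_geometric_max hβ₁ hβ₂) (norm_code_term_le hβ₁ hβ₂ s)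

/-- Self-similarity of the coding. -/
theorem codeStar_shiftOne (hβ₁ : β₁ ∈ Set.Ioo (0 : ℝ) 1) (hβ₂ : β₂ ∈ Set.Ioo (0 : ℝ) 1)
    (s : OneSided) : codeStar β₁ β₂ s =
      ratio β₁ β₂ (s 0) * (((s 0 : ℤ) : ℝ) + codeStar β₁ β₂ (shiftOne s)) := by
  rw [codeStar_eq, codeStar_eq, Summable.tsum_eq_zero_add
    (.of_norm_bounded (hasSum_geometric_max hβ₁ hβ₂).summable (norm_code_term_le hβ₁ hβ₂ s)),
    mul_add, ← tsum_mul_left]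
  congr 1
  · simp [scale, word, mul_comm]
  · refine tsum_congr fun k => ?_
    rw [scale_word_succ _ (k + 1), shiftOne]
    ring

/-- Each common first letter contracts the difference by its ratio; after `n` letters the uniform
bound on `codeStar` remains. -/
theorem abs_codeStar_sub_le (hβ₁ : β₁ ∈ Set.Ioo (0 : ℝ) 1) (hβ₂ : β₂ ∈ Set.Ioo (0 : ℝ) 1)
    (n : ℕ) {s s' : OneSided} (h : word n s = word n s') :
    |codeStar β₁ β₂ s - codeStar β₁ β₂ s'| ≤
      scale (ratio β₁ β₂) (word n s) * (2 * (1 - max β₁ β₂)⁻¹) := by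
  induction n generalizing s s' with
  | zero =>
    have h1 := abs_codeStar_le hβ₁ hβ₂ s
    have h2 := abs_codeStar_le hβ₁ hβ₂ s'
    have h3 := abs_sub (codeStar β₁ β₂ s) (codeStar β₁ β₂ s')
    simp only [scale, Finset.univ_eq_empty, Finset.prod_empty, one_mul]
    linarith
  | succ n ih =>
    have h0 : s' 0 = s 0 := (congrFun h 0).symm
    have hs : word n (shiftOne s) = word n (shiftOne s') := funext fun i => congrFun h i.succ
    have hr := ratio_pos hβ₁.1 hβ₂.1 (s 0)
    rw [codeStar_shiftOne hβ₁ hβ₂ s, codeStar_shiftOne hβ₁ hβ₂ s', h0, scale_word_succ, ← mul_sub,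
      add_sub_add_left_eq_sub, abs_mul, abs_of_pos hr, mul_assoc]
    exact mul_le_mul_of_nonneg_left (ih hs) hr.le

/-- Points with the same initial word have images whose distance is controlled by the scale of
the word and the distance of the second coordinates. -/
theorem exists_dist_code_le (hβ₁ : β₁ ∈ Set.Ioo (0 : ℝ) 1) (hβ₂ : β₂ ∈ Set.Ioo (0 : ℝ) 1) :
    ∃ D : ℝ, 0 ≤ D ∧ ∀ (n : ℕ) (s s' : TwoSided), word n (pr s) = word n (pr s') →
      dist (code β₁ β₂ s) (code β₁ β₂ s') ≤
        D * scale (ratio β₁ β₂) (word n (pr s)) + |codeSnd s - codeSnd s'| := by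
  set Λ := β₁ / (1 - β₁) - (-β₂ / (1 - β₂))
  have hm : 0 < (1 - max β₁ β₂)⁻¹ := inv_pos.2 (sub_pos.2 (max_lt hβ₁.2 hβ₂.2))
  refine ⟨|2 / Λ| * (2 * (1 - max β₁ β₂)⁻¹), by positivity, fun n s s' h => ?_⟩
  have h1 : codeFst β₁ β₂ (pr s) - codeFst β₁ β₂ (pr s') =
      2 / Λ * (codeStar β₁ β₂ (pr s) - codeStar β₁ β₂ (pr s')) := by
    simp only [codeFst, rescale]; ring
  have h2 : |codeFst β₁ β₂ (pr s) - codeFst β₁ β₂ (pr s')| ≤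
      |2 / Λ| * (2 * (1 - max β₁ β₂)⁻¹) * scale (ratio β₁ β₂) (word n (pr s)) := by
    rw [h1, abs_mul, mul_assoc, mul_comm (2 * _)]
    exact mul_le_mul_of_nonneg_left (abs_codeStar_sub_le hβ₁ hβ₂ n h) (abs_nonneg _)
  refine le_trans ?_ (add_le_add_left h2 _)
  rw [EuclideanSpace.dist_eq, Fin.sum_univ_two]
  simp only [code, Real.dist_eq, Matrix.cons_val_zero, Matrix.cons_val_one]
  refine Real.sqrt_le_iff.2 ⟨by positivity, ?_⟩
  nlinarith [mul_nonneg (abs_nonneg (codeFst β₁ β₂ (pr s) - codeFst β₁ β₂ (pr s')))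
    (abs_nonneg (codeSnd s - codeSnd s'))]

end

theorem abs_sub_le_of_floor_eq {r x y : ℝ} (hr : 0 < r) (hx : |x| ≤ 1) (hy : |y| ≤ 1)
    (h : ⌊(x + 1) / (2 * r)⌋₊ = ⌊(y + 1) / (2 * r)⌋₊) : |x - y| ≤ 2 * r := by
  obtain ⟨hx, -⟩ := abs_le.1 hx
  obtain ⟨hy, -⟩ := abs_le.1 hy
  have hr2 : 0 < 2 * r := by positivity
  have h1 := Nat.floor_le (div_nonneg (by linarith) hr2.le : 0 ≤ (x + 1) / (2 * r))
  have h2 := Nat.floor_le (div_nonneg (by linarith) hr2.le : 0 ≤ (y + 1) / (2 * r))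
  have h3 := Nat.lt_floor_add_one ((x + 1) / (2 * r))
  have h4 := Nat.lt_floor_add_one ((y + 1) / (2 * r))
  rw [h] at h1 h3
  rw [le_div_iff₀ hr2] at h1 h2
  rw [div_lt_iff₀ hr2] at h3 h4
  rw [abs_le]
  constructor <;> linarith

/-! ### Coverings -/

theorem hausdorffMeasure_code_frequently_eq_zero {β₁ β₂ : ℝ} (hβ₁ : β₁ ∈ Set.Ioo (0 : ℝ) 1)
    (hβ₂ : β₂ ∈ Set.Ioo (0 : ℝ) 1) (ν : Measure OneSided) [IsProbabilityMeasure ν] {t η K : ℝ}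
    (ht : 0 < t) (hη : 0 < η) (hK : 0 ≤ K) :
    μH[t + 1] (code β₁ β₂ ''
      {s | ∃ᶠ n in atTop, word n (pr s) ∈ goodWords ν (ratio β₁ β₂) t η K n}) = 0 := by
  set b := ratio β₁ β₂
  have hb := ratio_pos hβ₁.1 hβ₂.1
  have hb1 := ratio_lt_one hβ₁.2 hβ₂.2
  obtain ⟨D, hD, hdist⟩ := exists_dist_code_le hβ₁ hβ₂
  -- With `r = scale b w`, intervals of length `2r` starting at `-1` have indices at most `⌊1/r⌋` on
  -- `[-1, 1]`; the `+ 1` accounts for the right endpoint.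
  let N : ∀ {n : ℕ}, (Fin n → ℤˣ) → ℕ := fun w => ⌊(scale b w)⁻¹⌋₊ + 1
  let U : ∀ n, (Σ w : goodWords ν b t η K n, Fin (N w.1)) → Set (EuclideanSpace ℝ (Fin 2)) :=
    fun n p => code β₁ β₂ ''
      {s | word n (pr s) = p.1 ∧ ⌊(codeSnd s + 1) / (2 * scale b p.1.1)⌋₊ = p.2}
  have hdiam : ∀ n p, Metric.ediam (U n p) ≤ ENNReal.ofReal ((D + 2) * scale b p.1.1) := by
    rintro n p
    refine Metric.ediam_le ?_
    rintro _ ⟨s, ⟨hs, hs'⟩, rfl⟩ _ ⟨x, ⟨hx, hx'⟩, rfl⟩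
    rw [edist_dist]
    refine ENNReal.ofReal_le_ofReal ((hdist n s x (hs.trans hx.symm)).trans ?_)
    rw [hs, add_mul]
    gcongr
    exact abs_sub_le_of_floor_eq (scale_pos hb _) (abs_codeSnd_le s) (abs_codeSnd_le x)
      (hs'.trans hx'.symm)
  have hcover : ∀ n, code β₁ β₂ '' {s | word n (pr s) ∈ goodWords ν b t η K n} ⊆ ⋃ p, U n p := by
    rintro n _ ⟨s, hs, rfl⟩
    refine Set.mem_iUnion.2 ⟨⟨⟨_, hs⟩, ⟨⌊(codeSnd s + 1) / (2 * scale b (word n (pr s)))⌋₊, ?_⟩⟩,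
      Set.mem_image_of_mem _ ⟨rfl, rfl⟩⟩
    refine Nat.lt_succ_of_le (Nat.floor_le_floor ?_)
    have hpos : 0 < scale b (word n (pr s)) := scale_pos hb _
    rw [div_le_iff₀ (by positivity)]
    have h1 := (abs_le.1 (abs_codeSnd_le s)).2
    have h2 := inv_mul_cancel₀ hpos.ne'
    linarith
  set C : ℝ := 2 * (D + 2) ^ (t + 1) * K
  have hC : 0 ≤ C := by positivity
  have hword : ∀ n (w : goodWords ν b t η K n),
      ∑' j : Fin (N w.1), Metric.ediam (U n ⟨w, j⟩) ^ (t + 1) ≤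
        ENNReal.ofReal (C * Real.exp (-(η * n)) * cyl ν w.1) := by
    rintro n ⟨w, hw⟩
    have hr := scale_pos hb w
    have hr1 := scale_le_one hb hb1 w
    calc ∑' j : Fin (N w), Metric.ediam (U n ⟨⟨w, hw⟩, j⟩) ^ (t + 1)
        ≤ ∑' j : Fin (N w), ENNReal.ofReal (((D + 2) * scale b w) ^ (t + 1)) := by
          refine ENNReal.tsum_le_tsum fun j => ?_
          rw [← ENNReal.ofReal_rpow_of_nonneg (by positivity) (by positivity)]
          exact ENNReal.rpow_le_rpow (hdiam n ⟨⟨w, hw⟩, j⟩) (by positivity)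
      _ = ENNReal.ofReal (N w * ((D + 2) * scale b w) ^ (t + 1)) := by
          rw [tsum_fintype, Finset.sum_const, Finset.card_univ, Fintype.card_fin, nsmul_eq_mul,
            ENNReal.ofReal_mul (by positivity), ENNReal.ofReal_natCast]
      _ ≤ _ := by
          refine ENNReal.ofReal_le_ofReal ?_
          -- Since `scale b w ≤ 1`, the extra interval costs at most `1`. This factor uses up the `+
          -- 1` in the exponent `t + 1`.
          have hN : (N w : ℝ) * scale b w ≤ 2 := by
            have h1 := Nat.floor_le (inv_nonneg.2 hr.le)
            have h2 : (scale b w)⁻¹ * scale b w = 1 := inv_mul_cancel₀ hr.ne'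
            simp only [N]
            push_cast
            nlinarith
          rw [Real.mul_rpow (by positivity) hr.le, Real.rpow_add_one hr.ne']
          calc (N w : ℝ) * ((D + 2) ^ (t + 1) * (scale b w ^ t * scale b w))
              = (N w * scale b w) * ((D + 2) ^ (t + 1) * scale b w ^ t) := by ring
            _ ≤ 2 * ((D + 2) ^ (t + 1) * (K * Real.exp (-(η * n)) * cyl ν w)) := by
                gcongr
                exact hw
            _ = C * Real.exp (-(η * n)) * cyl ν w := by ring
  have hlevel : ∀ n, ∑' p, Metric.ediam (U n p) ^ (t + 1) ≤
      ENNReal.ofReal (C * Real.exp (-(η * n))) := by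
    intro n
    rw [ENNReal.tsum_sigma']
    refine (ENNReal.tsum_le_tsum (hword n)).trans ((ENNReal.tsum_comp_le_tsum_of_injective
      Subtype.val_injective fun w : Fin n → ℤˣ =>
        ENNReal.ofReal (C * Real.exp (-(η * n)) * cyl ν w)).trans ?_)
    rw [tsum_fintype, ← ENNReal.ofReal_sum_of_nonneg
      fun w _ => mul_nonneg (by positivity) (cyl_nonneg ν w), ← Finset.mul_sum, sum_cyl, mul_one]
  have hsummable : Summable fun n : ℕ => C * Real.exp (-(η * n)) := by
    refine Summable.mul_left _ ?_
    have := Real.summable_exp_nat_mul_iff.2 (neg_lt_zero.2 hη)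
    refine this.congr fun n => ?_
    congr 1
    ring
  refine measure_mono_null ?_ (hausdorffMeasure_frequently_eq_zero (by positivity) U hcover
    (ne_top_of_le_ne_top hsummable.tsum_ofReal_ne_top (ENNReal.tsum_le_tsum hlevel)))
  rintro _ ⟨s, hs, rfl⟩
  exact hs.mono fun n hn => Set.mem_image_of_mem _ hn

theorem hausdorffMeasure_code_goodPoints_eq_zero {β₁ β₂ : ℝ} (hβ₁ : β₁ ∈ Set.Ioo (0 : ℝ) 1)
    (hβ₂ : β₂ ∈ Set.Ioo (0 : ℝ) 1) (ν : Measure OneSided) [IsProbabilityMeasure ν] {t η : ℝ}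
    (ht : 0 < t) (hη : 0 < η) :
    μH[t + 1] (code β₁ β₂ '' (pr ⁻¹' goodPoints ν (ratio β₁ β₂) t η)) = 0 := by
  refine measure_mono_null ?_ (measure_iUnion_null fun K : ℕ =>
    hausdorffMeasure_code_frequently_eq_zero hβ₁ hβ₂ ν ht hη K.cast_nonneg)
  rintro _ ⟨s, ⟨K, hK⟩, rfl⟩
  exact Set.mem_iUnion.2 ⟨K, Set.mem_image_of_mem _ hK⟩

/-! ### The exponent -/

theorem ergodic_marginal {μ : Measure TwoSided} (hμ : Ergodic shift μ) :
    Ergodic shiftOne (marginal μ) :=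
  (MeasurePreserving.mk measurable_pr rfl).ergodic_of_ergodic_semiconj hμ measurable_shiftOne
    fun _ => rfl

theorem integral_letter (ν : Measure OneSided) [IsProbabilityMeasure ν] (g : ℤˣ → ℝ) :
    ∫ s, g (s 0) ∂ν = ν.real {s | s 0 = 1} * g 1 + ν.real {s | s 0 = -1} * g (-1) := by
  have h := integral_comp_eq_sum (ν := ν) (ξ := fun s : OneSided => s 0) (measurable_pi_apply 0) g
  rw [h, UnitsInt.univ, Finset.sum_pair (by decide)]
  rfl

theorem xi_eq (β₁ β₂ : ℝ) (ν : Measure OneSided) [IsProbabilityMeasure ν] :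
    xi β₁ β₂ ν = -∫ s, Real.log (ratio β₁ β₂ (s 0)) ∂ν := by
  rw [integral_letter ν fun u => Real.log (ratio β₁ β₂ u), xi, ratio, ratio, if_pos rfl,
    if_neg (by decide)]

theorem xi_pos {β₁ β₂ : ℝ} (hβ₁ : β₁ ∈ Set.Ioo (0 : ℝ) 1) (hβ₂ : β₂ ∈ Set.Ioo (0 : ℝ) 1)
    (ν : Measure OneSided) [IsProbabilityMeasure ν] : 0 < xi β₁ β₂ ν := by
  have h := integral_letter ν fun _ => 1
  simp only [integral_const, probReal_univ, smul_eq_mul, mul_one] at h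
  have h1 := Real.log_neg hβ₁.1 hβ₁.2
  have h2 := Real.log_neg hβ₂.1 hβ₂.2
  have hp : 0 ≤ ν.real {s | s 0 = 1} := measureReal_nonneg
  have hq : 0 ≤ ν.real {s | s 0 = -1} := measureReal_nonneg
  unfold xi
  rcases hp.eq_or_lt with hp | hp
  · rw [← hp] at h ⊢
    nlinarith
  · nlinarith [mul_pos_of_neg_of_neg h1 (neg_lt_zero.2 hp), mul_nonneg hq (neg_nonneg.2 h2.le)]

end GenBaker

theorem proposition5p2 (β₁ β₂ : ℝ) (hβ₁ : β₁ ∈ Set.Ioo (0 : ℝ) 1) (hβ₂ : β₂ ∈ Set.Ioo (0 : ℝ) 1)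
    (hβ : 1 ≤ β₁ + β₂) (μ : Measure GenBaker.TwoSided) [IsProbabilityMeasure μ]
    (hμ : Ergodic GenBaker.shift μ) :
    GenBaker.measureDimH (GenBaker.projected β₁ β₂ μ) ≤
      GenBaker.metricEntropy GenBaker.shiftOne (GenBaker.marginal μ) /
        ENNReal.ofReal (GenBaker.xi β₁ β₂ (GenBaker.marginal μ)) + 1 := by
  have hν : IsProbabilityMeasure (GenBaker.marginal μ) :=
    Measure.isProbabilityMeasure_map GenBaker.measurable_pr.aemeasurable
  have hΞ := GenBaker.xi_pos hβ₁ hβ₂ (GenBaker.marginal μ)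
  have hΞ' := GenBaker.xi_eq β₁ β₂ (GenBaker.marginal μ)
  set ν := GenBaker.marginal μ with hνdef
  set Ξ := GenBaker.xi β₁ β₂ ν
  -- The hypothesis `hfin` disposes of the case of an infinite right-hand side.
  refine ENNReal.le_of_forall_pos_le_add fun ε hε hfin => ?_
  set x := GenBaker.metricEntropy GenBaker.shiftOne ν / ENNReal.ofReal Ξ with hx
  have hxtop : x ≠ ∞ := (le_self_add.trans_lt hfin).ne
  lift x to NNReal using hxtop with y
  have hε' : (0 : ℝ) < ε := hε
  have ht : (0 : ℝ) < y + ε := by positivity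
  -- With `η = εΞ/4`, `(y + ε)Ξ - 2η = yΞ + εΞ/2`, strictly above the entropy `yΞ`.
  have hη : 0 < ε * Ξ / 4 := by positivity
  have hh : GenBaker.metricEntropy GenBaker.shiftOne ν <
      ENNReal.ofReal ((y + ε) * -∫ s, Real.log (GenBaker.ratio β₁ β₂ (s 0)) ∂ν -
        2 * (ε * Ξ / 4)) := by
    rw [← hΞ', ← ENNReal.div_mul_cancel (a := ENNReal.ofReal Ξ)
      (b := GenBaker.metricEntropy GenBaker.shiftOne ν) (ENNReal.ofReal_pos.2 hΞ).ne'
      ENNReal.ofReal_ne_top, ← hx, ← ENNReal.ofReal_coe_nnreal, ← ENNReal.ofReal_mul y.coe_nonneg]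
    refine (ENNReal.ofReal_lt_ofReal_iff_of_nonneg (by positivity)).2 ?_
    nlinarith [mul_pos hε' hΞ]
  have hae := GenBaker.ae_mem_goodPoints (GenBaker.ergodic_marginal hμ)
    (GenBaker.ratio_pos hβ₁.1 hβ₂.1) ht hη hh
  have hdim := GenBaker.measureDimH_le_of_hausdorffMeasure_eq_zero (d := y + ε + 1)
    (GenBaker.measurable_code β₁ β₂)
    (ae_of_ae_map GenBaker.measurable_pr.aemeasurable hae)
    (GenBaker.hausdorffMeasure_code_goodPoints_eq_zero hβ₁ hβ₂ ν ht hη)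
  refine hdim.trans_eq ?_
  push_cast
  ring
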